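/- Let $2\le n<\infty$, let $\mathbb F_n$ be the free group of rank $n$, let $G$ be a free group, and let $\alpha\colon G\to\operatorname{Aut}(\mathbb F_n)$ be any action of $G$ on $\mathbb F_n$ by automorphisms. Then the semidirect product $\mathbb F_n\rtimes_\alpha G$ is hyperlinear. Here a discrete group $\Gamma$ is called hyperlinear if for every finite subset $F\subseteq\Gamma$ and every $\varepsilon>0$ there exist an integer $d\ge 1$ and a map $\theta\colon\Gamma\to U(d)$ into the group of unitary $d\times d$ matrices such that $\|\theta(gh)-\theta(g)\theta(h)\|_2\le\varepsilon$ for all $g,h\in F$ and $|\operatorname{tr}_d(\theta(g))|\le\varepsilon$ for all $g\in F\setminus\{1\}$, where $\operatorname{tr}_d=\frac1d\operatorname{Tr}$ is the normalized trace and $\|A\|_2=\operatorname{tr}_d(A^*A)^{1/2}$ is the normalized Hilbert–Schmidt norm. -/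

import Mathlib

/-- The normalized trace `tr_d(A) = (1/d) ∑ i, A i i` of a complex `d × d` matrix. It is used only
for `d ≥ 1`. -/
noncomputable def normalizedTrace {d : ℕ} (A : Matrix (Fin d) (Fin d) ℂ) : ℂ :=
  A.trace / (d : ℂ)

/-- The normalized Hilbert-Schmidt norm `‖A‖₂ = tr_d(A* A)^(1/2)` of a complex `d × d` matrix;
entrywise, `‖A‖₂² = (1/d) ∑ i, ∑ j, |A i j|²`. It is used only for `d ≥ 1`. -/
noncomputable def normalizedHSNorm {d : ℕ} (A : Matrix (Fin d) (Fin d) ℂ) : ℝ :=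
  Real.sqrt ((∑ i, ∑ j, ‖A i j‖ ^ 2) / (d : ℝ))

/-- A discrete group `Γ` is hyperlinear if it has unitary matrix microstates: for every finite
subset `F` of `Γ` and every `ε > 0` there are `d ≥ 1` and a map `θ` from `Γ` to the unitary group
`U(d)` that on `F` is multiplicative up to `ε` in the normalized Hilbert-Schmidt norm, and under
which the normalized trace of each nontrivial element of `F` is at most `ε` in modulus. The map
`θ` itself need not be a homomorphism.

In other words, the canonical trace of the group von Neumann algebra of `Γ` is approximated by
the normalized traces of unitary matrices. As `‖u - 1‖₂² = 2 - 2 Re tr(u)` for unitary `u`, the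
last condition says that nontrivial elements are moved to a distance about `√2` from `1`. -/
def IsHyperlinear (Γ : Type*) [Group Γ] : Prop :=
  ∀ (F : Finset Γ) (ε : ℝ), 0 < ε →
    ∃ (d : ℕ) (_ : 0 < d) (θ : Γ → Matrix.unitaryGroup (Fin d) ℂ),
      (∀ g ∈ F, ∀ h ∈ F,
        normalizedHSNorm ((θ (g * h) : Matrix (Fin d) (Fin d) ℂ) -
          (θ g : Matrix (Fin d) (Fin d) ℂ) * (θ h : Matrix (Fin d) (Fin d) ℂ)) ≤ ε) ∧
      (∀ g ∈ F, g ≠ 1 → ‖normalizedTrace (θ g : Matrix (Fin d) (Fin d) ℂ)‖ ≤ ε)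

/-! The group is residually finite, and a regular representation of a finite quotient has trace zero
at every element outside the kernel. Residual finiteness passes from the free factors to the
semidirect product by Mal'cev's argument: a finitely generated `N` has only finitely many
homomorphisms to a finite group `P`, so all of them together give a finite action of `N` that
automorphisms merely permute, and it extends to `N ⋊[φ] G`. -/

/-- The representation of the symmetric group on `d` points by permutation matrices, viewed as
unitary matrices. -/
noncomputable def permUnitary (d : ℕ) : Equiv.Perm (Fin d) →* Matrix.unitaryGroup (Fin d) ℂ where
  toFun σ := ⟨(σ⁻¹).permMatrix ℂ, by
    rw [Matrix.mem_unitaryGroup_iff', Matrix.star_eq_conjTranspose,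
      Matrix.conjTranspose_permMatrix, ← Matrix.permMatrix_mul]
    simp⟩
  map_one' := Subtype.ext (by simp)
  map_mul' σ τ := Subtype.ext (by simp [Matrix.permMatrix_mul])

theorem normalizedTrace_permUnitary_of_forall_ne {d : ℕ} (σ : Equiv.Perm (Fin d))
    (hσ : ∀ i, σ i ≠ i) :
    normalizedTrace (permUnitary d σ : Matrix (Fin d) (Fin d) ℂ) = 0 := by
  have h : Matrix.trace ((σ⁻¹).permMatrix ℂ) = 0 := by
    rw [Matrix.trace_permutation, Nat.cast_eq_zero, Set.ncard_eq_zero]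
    refine Set.eq_empty_of_forall_notMem fun i hi => hσ i ?_
    exact (Equiv.Perm.inv_eq_iff_eq.mp hi).symm
  change Matrix.trace ((σ⁻¹).permMatrix ℂ) / (d : ℂ) = 0
  rw [h, zero_div]

/-- A residually finite group is hyperlinear: the regular representations of its finite quotients
are exact microstates. -/
theorem IsHyperlinear.of_residuallyFinite (Γ : Type*) [Group Γ] [Group.ResiduallyFinite Γ] :
    IsHyperlinear Γ := by
  classical
  intro F ε hε
  have hsep : ∀ g : Γ, ∃ H : Subgroup Γ, H.Normal ∧ H.FiniteIndex ∧ (g ≠ 1 → g ∉ H) := by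
    intro g
    by_cases hg : g = 1
    -- A default value: nothing has to be separated from `1`.
    · exact ⟨⊤, inferInstance, inferInstance, fun h => absurd hg h⟩
    · obtain ⟨H, hH⟩ := Group.exists_finiteIndexNormalSubgroup_notMem g hg
      exact ⟨H.toSubgroup, inferInstance, inferInstance, fun _ => hH⟩
  choose H hnormal hindex hmem using hsep
  let K : Subgroup Γ := ⨅ g : F, H g
  have : K.Normal := Subgroup.normal_iInf_normal fun g => hnormal g
  have : K.FiniteIndex := Subgroup.finiteIndex_iInf fun g => hindex g
  let e : (Γ ⧸ K) ≃ Fin (Nat.card (Γ ⧸ K)) := Finite.equivFin _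
  let ρ : Γ →* Equiv.Perm (Fin (Nat.card (Γ ⧸ K))) :=
    (e.permCongrHom.toMonoidHom.comp (MulAction.toPermHom (Γ ⧸ K) (Γ ⧸ K))).comp
      (QuotientGroup.mk' K)
  refine ⟨Nat.card (Γ ⧸ K), Nat.card_pos, (permUnitary _).comp ρ, fun g _ h _ => ?_,
    fun g hg hg1 => ?_⟩
  · simp [normalizedHSNorm, hε.le]
  · have hfix : ∀ i, ρ g i ≠ i := by
      intro i hi
      have hq : (QuotientGroup.mk' K g) * e.symm i = e.symm i := by
        apply e.injective
        simpa [ρ] using hi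
      have hgK : g ∈ K := by
        rw [← QuotientGroup.eq_one_iff]
        exact mul_eq_right.mp hq
      exact hmem g hg1 (Subgroup.mem_iInf.mp hgK ⟨g, hg⟩)
    have h0 := normalizedTrace_permUnitary_of_forall_ne (ρ g) hfix
    simp only [MonoidHom.comp_apply, h0, norm_zero, hε.le]

/-- On a finite subset of a group, the partially defined left translation by `a` extends to a
permutation. -/
theorem exists_perm_extending_mul_left {G : Type*} [Group G] (S : Finset G) (a : G) :
    ∃ σ : Equiv.Perm S, ∀ s : S, ∀ h : a * (s : G) ∈ S, σ s = ⟨a * s, h⟩ := by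
  obtain ⟨σ, hσ⟩ := Equiv.Perm.exists_extending_pair
    (fun s : {s : S // a * (s : G) ∈ S} => (s : S))
    (fun s : {s : S // a * (s : G) ∈ S} => (⟨a * (s : S), s.2⟩ : S))
    Subtype.val_injective
    (fun s t hst => Subtype.ext (Subtype.ext (mul_left_cancel (congrArg Subtype.val hst))))
  exact ⟨σ, fun s h => hσ ⟨s, h⟩⟩

/-- Free groups are residually finite: an element `w` is detected on the finite set of suffixes of
a word representing it, where each generator acts by extending its partial left translation. -/
instance FreeGroup.residuallyFinite (X : Type*) : Group.ResiduallyFinite (FreeGroup X) := by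
  classical
  refine Group.residuallyFinite_of_forall_exists_finite_monoidHom fun w hw => ?_
  let S : Finset (FreeGroup X) := (w.toWord.tails.map FreeGroup.mk).toFinset
  have hS : ∀ L : List (X × Bool), L <:+ w.toWord → FreeGroup.mk L ∈ S := fun L hL =>
    List.mem_toFinset.mpr (List.mem_map_of_mem ((List.mem_tails _ _).mpr hL))
  choose σ hσ using fun x : X => exists_perm_extending_mul_left S (FreeGroup.of x)
  let f : FreeGroup X →* Equiv.Perm S := FreeGroup.lift σ
  have hone : (1 : FreeGroup X) ∈ S := hS [] (List.nil_suffix)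
  have hact : ∀ L : List (X × Bool), ∀ hL : L <:+ w.toWord,
      f (FreeGroup.mk L) ⟨1, hone⟩ = ⟨FreeGroup.mk L, hS L hL⟩ := by
    intro L
    induction L with
    | nil => intro hL; rfl
    | cons p L ih =>
      intro hL
      have hL' : L <:+ w.toWord := (List.suffix_cons p L).trans hL
      have hcons : FreeGroup.mk (p :: L) = FreeGroup.mk [p] * FreeGroup.mk L := by
        rw [FreeGroup.mul_mk, List.singleton_append]
      have hstep : f (FreeGroup.mk [p]) ⟨FreeGroup.mk L, hS L hL'⟩ =
          ⟨FreeGroup.mk (p :: L), hS _ hL⟩ := by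
        obtain ⟨x, b⟩ := p
        cases b with
        | true =>
          have hx : f (FreeGroup.mk [(x, true)]) = σ x := FreeGroup.lift_apply_of
          rw [hx, hσ x _ (by exact hcons ▸ hS _ hL)]
          exact Subtype.ext hcons.symm
        | false =>
          have hinv : FreeGroup.mk [(x, false)] = (FreeGroup.of x)⁻¹ := rfl
          have hx : f (FreeGroup.mk [(x, false)]) = (σ x)⁻¹ := by
            rw [hinv, _root_.map_inv]
            exact congrArg _ FreeGroup.lift_apply_of
          have hmul : FreeGroup.of x * FreeGroup.mk ((x, false) :: L) = FreeGroup.mk L := by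
            rw [hcons, hinv, mul_inv_cancel_left]
          -- An inverse letter is the same partial translation read backwards: `σ x` carries the
          -- longer suffix to the shorter one.
          rw [hx, Equiv.Perm.inv_eq_iff_eq, hσ x _ (by exact hmul ▸ hS L hL')]
          exact Subtype.ext hmul.symm
      rw [← hstep, ← ih hL', hcons, _root_.map_mul, Equiv.Perm.mul_apply]
  refine ⟨Equiv.Perm S, inferInstance, inferInstance, f, fun hf => hw ?_⟩
  have hval : (f (FreeGroup.mk w.toWord) ⟨1, hone⟩ : FreeGroup X) = FreeGroup.mk w.toWord :=
    congrArg Subtype.val (hact w.toWord (List.suffix_refl _))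
  rw [FreeGroup.mk_toWord, hf] at hval
  exact hval.symm

theorem Group.ResiduallyFinite.of_injective {G H : Type*} [Group G] [Group H]
    [Group.ResiduallyFinite H] (f : G →* H) (hf : Function.Injective f) :
    Group.ResiduallyFinite G := by
  rw [Group.residuallyFinite_iff_forall_finiteIndexNormalSubgroup]
  exact fun g hg => hf ((Group.eq_one_iff_forall_finiteIndexNormalSubroup (f g)
    fun K => hg (K.comap f)).trans (map_one f).symm)

instance IsFreeGroup.residuallyFinite (G : Type*) [Group G] [IsFreeGroup G] :
    Group.ResiduallyFinite G :=
  .of_injective (IsFreeGroup.toFreeGroup G).toMonoidHom (IsFreeGroup.toFreeGroup G).injective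

/-- A group acting on `N` acts by permutations of coordinates on the power of `P` indexed by the
homomorphisms `N →* P`. -/
def permCoordinates {N G : Type*} (P : Type*) [Group N] [Group G] [Group P] (φ : G →* MulAut N) :
    G →* Equiv.Perm ((N →* P) → P) where
  toFun g :=
    { toFun := fun F f => F (f.comp (φ g).toMonoidHom)
      invFun := fun F f => F (f.comp (φ g⁻¹).toMonoidHom)
      left_inv := fun F => funext fun f => congrArg F (by ext; simp)
      right_inv := fun F => funext fun f => congrArg F (by ext; simp) }
  map_one' := by
    ext F f
    exact congrArg F (by ext; simp)
  map_mul' g h := by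
    ext F f
    exact congrArg F (by ext; simp)

/-- The action of `N ⋊[φ] G` on the power of `P` indexed by `N →* P`, in which `N` acts by left
multiplication through evaluation and `G` by permutations of coordinates. -/
def SemidirectProduct.toPermPi {N G : Type*} (P : Type*) [Group N] [Group G] [Group P]
    (φ : G →* MulAut N) : N ⋊[φ] G →* Equiv.Perm ((N →* P) → P) :=
  SemidirectProduct.lift
    ((MulAction.toPermHom ((N →* P) → P) ((N →* P) → P)).comp (MonoidHom.pi id))
    (permCoordinates P φ) (by
      intro g
      ext n F f
      -- Conjugation by `g` makes `n` act on coordinate `f` through `f.comp (φ g)`, which is how `φ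
      -- g n` acts there.
      have hF : F f = F ((f.comp (φ g).toMonoidHom).comp (φ g⁻¹).toMonoidHom) :=
        congrArg F (by ext; simp)
      simpa [permCoordinates] using hF)

/-- **Mal'cev**: a semidirect product of a finitely generated residually finite group by a
residually finite group is residually finite. -/
theorem SemidirectProduct.residuallyFinite {N G : Type*} [Group N] [Group G] [Group.FG N]
    [Group.ResiduallyFinite N] [Group.ResiduallyFinite G] (φ : G →* MulAut N) :
    Group.ResiduallyFinite (N ⋊[φ] G) := by
  rw [Group.residuallyFinite_iff_exists_finiteIndex]
  intro g hg
  by_cases hr : g.right = 1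
  · have hl : g.left ≠ 1 := fun hl => hg (SemidirectProduct.ext hl hr)
    obtain ⟨K, hK⟩ := Group.exists_finiteIndexNormalSubgroup_notMem g.left hl
    let P := N ⧸ K.toSubgroup
    -- Finite generation enters here: it makes the permuted set finite, so the kernel below has
    -- finite index.
    have : Finite (N →* P) := by
      obtain ⟨S, hS⟩ := Group.FG.out (G := N)
      refine Finite.of_injective (fun (f : N →* P) (s : S) => f s) fun f₁ f₂ h => ?_
      exact MonoidHom.eq_of_eqOn_dense hS fun s hs => congrFun h ⟨s, hs⟩
    refine ⟨(SemidirectProduct.toPermPi P φ).ker, inferInstance, fun hker => hK ?_⟩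
    rw [MonoidHom.mem_ker, ← SemidirectProduct.inl_left_mul_inr_right g, hr, map_one, mul_one,
      SemidirectProduct.toPermPi, SemidirectProduct.lift_inl] at hker
    -- At the constant function `1`, the coordinate of the quotient map reads off the class of
    -- `g.left` in `P`.
    have h := congrFun (DFunLike.congr_fun hker 1) (QuotientGroup.mk' K.toSubgroup)
    rw [← FiniteIndexNormalSubgroup.mem_toSubgroup_iff, ← QuotientGroup.eq_one_iff]
    exact (mul_one _).symm.trans h
  · obtain ⟨K, hK⟩ := Group.exists_finiteIndexNormalSubgroup_notMem g.right hr
    exact ⟨(K.comap SemidirectProduct.rightHom).toSubgroup, inferInstance, hK⟩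

/-- For `2 ≤ n < ∞`, every free group `G` and every action `α` of `G` on the free group of rank
`n` by automorphisms, the semidirect product is hyperlinear. -/
theorem theorem5p3 (n : ℕ) (hn : 2 ≤ n) (G : Type*) [Group G] [IsFreeGroup G]
    (α : G →* MulAut (FreeGroup (Fin n))) :
    IsHyperlinear (FreeGroup (Fin n) ⋊[α] G) := by
  have := SemidirectProduct.residuallyFinite α
  exact IsHyperlinear.of_residuallyFinite _
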